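/- **Exponential convergence of ReLU CNNs for deep sparse coding in the $\ell_2$ norm.** Definitions. For a matrix $A$ with columns $a_k$ put $\mu(A)=\max_{i\ne j}|a_i^\top a_j|/(\|a_i\|_2\|a_j\|_2)$ ($0$ if there is only one column); $\|x\|_0$ is the number of nonzero entries of $x$. Given dictionaries $D_j\in\mathbb R^{d_{j-1}\times d_j}$ ($1\le j\le J$, $J\ge1$, all $d_j\ge1$), sparsity levels $\lambda_j\ge0$ and tolerances $\varepsilon_j\ge0$, vectors $x_j\in\mathbb R^{d_j}$ ($1\le j\le J$) are a solution of the deep sparse coding problem for $y\in\mathbb R^{d_0}$ if, with $x_0:=y$, $\|x_{j-1}-D_jx_j\|_2\le\varepsilon_j$ and $\|x_j\|_0\le\lambda_j$ for all $j$. A (1-D, multi-channel, ReLU) CNN with kernel size $s$, depth $L$, channel numbers $n_0=1,n_1,\dots,n_L\ge1$ and strides $t_1,\dots,t_L\ge1$ has layers $h_0(y)=y\in\mathbb R^{d_0}$ and $$h_l(y)_{c}=\max\Big\{\sum_{i=1}^{n_{l-1}} w^{(l)}_{c,i}*_{t_l}h_{l-1}(y)_i+b^{(l)}_{c}\mathbf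 1,\,0\Big\}\in\mathbb R^{m_l},\qquad 1\le c\le n_l,$$ where $w^{(l)}_{c,i}\in\mathbb R^s$, $b^{(l)}_c\in\mathbb R$, $m_0=d_0$, $m_l=\lceil m_{l-1}/t_l\rceil$ and $(w*_tx)_p=\sum_{k=1}^s w_kx_{(p-1)t+k}$, entries of $x$ outside its range being $0$. Its weights are the entries of all $w^{(l)}_{c,i}$ and all biases $b^{(l)}_c$. As ReLU layers are nonnegative, signed vectors are read off as differences of channels: a layer $l$ with $m_l=1$ and $n_l\ge2m$ is said to carry the output $z\in\mathbb R^m$ with $z_i=h_l(y)_{i}-h_l(y)_{m+i}$, $1\le i\le m$. Theorem. There is an absolute constant $A>0$ with the following property. Let $D_j\in\mathbb R^{d_{j-1}\times d_j}$, $1\le j\le J$, have columns of $\ell_2$ norm $1$, and let $\lambda_j\ge 0$ satisfy $\lambda_j<\frac12\big(1+\frac1{\mu(D_j)}\big)$ for all $j$ (no condition if $\mu(D_j)=0$). Let $B_j,\delta_j\ge0$, and let $s\ge2$, $K\ge1$ be integers. Then there are constants $C_D>0$, depending only on $D=(D_j)_j$, $c_{D,\lambda}>0$, depending only on $D$ and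 $\lambda=(\lambda_j)_j$, and $C_{D,B,\lambda}>0$, depending only on $D,\lambda$ and $B=(B_j)_j$, and a CNN with kernel size $s$ and input dimension $d_0$, of depth $$L\le A\,K\log_s\prod_{j=1}^J\max\{s,\,d_{j-1}+d_j\},$$ with at most $A\,K\prod_{j=1}^J(d_{j-1}+d_j)^2$ nonzero weights and at most $A\,s\,K\prod_{j=1}^J(d_{j-1}+d_j)^2$ weights in total, and layers $l_1<\dots<l_J=L$ carrying outputs $\tilde x_1\in\mathbb R^{d_1},\dots,\tilde x_J\in\mathbb R^{d_J}$, such that, for all tolerances $\varepsilon_j\ge0$, all $y\in\mathbb R^{d_0}$ and all solutions $(x_j)_{j=1}^J$ of the deep sparse coding problem for $y$ with $\max_i|(x_j)_i|\le B_j$ and $\|x_{j-1}-D_jx_j\|_1\le\delta_j$ for all $j$ (where $x_0=y$), the outputs on the input $y$ satisfy $$\|\tilde x_j-x_j\|_2\le C_{D,B,\lambda}\,e^{-c_{D,\lambda}K}+C_D\sum_{i=1}^j\delta_i,\qquad 1\le j\le J.$$ -/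

import Mathlib

open scoped BigOperators Matrix

noncomputable section

/-- The `ℓ₂` norm of a real vector. -/
def l2norm {ι : Type*} [Fintype ι] (v : ι → ℝ) : ℝ := ‖(WithLp.toLp 2 v : EuclideanSpace ℝ ι)‖

/-- The `ℓ₁` norm of a real vector. -/
def l1norm {ι : Type*} [Fintype ι] (v : ι → ℝ) : ℝ := ∑ i, |v i|

open Classical in
/-- The number of nonzero entries of a real vector. -/
def l0norm {ι : Type*} [Fintype ι] (v : ι → ℝ) : ℕ := (Finset.univ.filter fun i => v i ≠ 0).card

/-- Every column has `ℓ₂` norm one. -/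
def ColumnNormalized {m d : ℕ} (A : Matrix (Fin m) (Fin d) ℝ) : Prop :=
  ∀ k, l2norm (fun i => A i k) = 1

/-- The mutual coherence: the maximum over `i ≠ j` of `|aᵢᵀ aⱼ| / (‖aᵢ‖₂ ‖aⱼ‖₂)`, where `aᵢ` is the
`i`-th column (`0` if there is only one column). -/
def mutualCoherence {m d : ℕ} (A : Matrix (Fin m) (Fin d) ℝ) : ℝ :=
  ⨆ p : {p : Fin d × Fin d // p.1 ≠ p.2},
    |(fun i => A i p.1.1) ⬝ᵥ (fun i => A i p.1.2)| /
      (l2norm (fun i => A i p.1.1) * l2norm (fun i => A i p.1.2))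

/-- The condition `λ < (1 + 1 / μ(A)) / 2`, with the convention `1 / 0 = ∞`. -/
def UniquenessCondition {m d : ℕ} (A : Matrix (Fin m) (Fin d) ℝ) (lam : ℝ) : Prop :=
  0 < mutualCoherence A → lam < (1 + 1 / mutualCoherence A) / 2

/-- The residual `x_{j-1} - D_j x_j` of a layer. The layers `1, …, J` are indexed by `Fin J`, the
vectors `x_0, …, x_J` by `Fin (J + 1)`. -/
def layerNoise {J : ℕ} {d : Fin (J + 1) → ℕ}
    (D : (j : Fin J) → Matrix (Fin (d j.castSucc)) (Fin (d j.succ)) ℝ)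
    (x : (j : Fin (J + 1)) → Fin (d j) → ℝ) (j : Fin J) : Fin (d j.castSucc) → ℝ :=
  x j.castSucc - D j *ᵥ x j.succ

/-- `x_1, …, x_J` solves the deep sparse coding problem for the observation `y`, the dictionaries
`D_j`, the sparsity levels `λ_j` and the tolerances `ε_j`; the convention `x_0 = y` is used. -/
structure IsDSCSolution {J : ℕ} {d : Fin (J + 1) → ℕ}
    (D : (j : Fin J) → Matrix (Fin (d j.castSucc)) (Fin (d j.succ)) ℝ) (lam ε : Fin J → ℝ)
    (y : Fin (d 0) → ℝ) (x : (j : Fin (J + 1)) → Fin (d j) → ℝ) : Prop where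
  zero_eq : x 0 = y
  residual_le : ∀ j, l2norm (layerNoise D x j) ≤ ε j
  sparse : ∀ j : Fin J, (l0norm (x j.succ) : ℝ) ≤ lam j

/-- A multi-channel one-dimensional convolutional network with input size `d` and kernel size `s`
in every layer. Channels, positions and kernel entries are numbered from `0`. The data `stride l`,
`filter l`, `bias l` belong to the passage from layer `l` to layer `l + 1`; only the values with
`l < depth`, output channel `< chan (l + 1)`, input channel `< chan l` and kernel entry `< s` are
ever used. -/
structure ConvNet (s d : ℕ) where
  depth : ℕ
  chan : ℕ → ℕ
  chan_zero : chan 0 = 1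
  chan_pos : ∀ l, 1 ≤ chan l
  stride : ℕ → ℕ
  stride_pos : ∀ l, 1 ≤ stride l
  /-- `filter l o i k` is the `k`-th entry of the kernel from input channel `i` to output
  channel `o`. -/
  filter : ℕ → ℕ → ℕ → ℕ → ℝ
  bias : ℕ → ℕ → ℝ

namespace ConvNet

variable {s d : ℕ}

/-- The length of the signals in layer `l`: `d_0 = d` and `d_{l+1} = ⌈d_l / t_l⌉`. -/
def width (Φ : ConvNet s d) : ℕ → ℕ
  | 0 => d
  | l + 1 => Φ.width l ⌈/⌉ Φ.stride l

/-- `Φ.feature y l c p` is entry `p` of channel `c` of layer `l` on the input `y`; it is `0` outside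
the ranges `c < chan l`, `p < width l`, which is the zero padding of the convolutions. -/
def feature (Φ : ConvNet s d) (y : Fin d → ℝ) : ℕ → ℕ → ℕ → ℝ
  | 0 => fun c p => if h : c = 0 ∧ p < d then y ⟨p, h.2⟩ else 0
  | l + 1 => fun c p =>
      if c < Φ.chan (l + 1) ∧ p < Φ.width (l + 1) then
        max (∑ i ∈ Finset.range (Φ.chan l), ∑ k ∈ Finset.range s,
          Φ.filter l c i k * Φ.feature y l i (p * Φ.stride l + k) + Φ.bias l c) 0
      else 0

/-- The signed vector of size `m` carried by layer `l`: the matrix `(I, -I)` applied to the first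
`2 m` channels (at position `0`) of that layer. -/
def signedOutput (Φ : ConvNet s d) (y : Fin d → ℝ) (l m : ℕ) : Fin m → ℝ :=
  fun i => Φ.feature y l i 0 - Φ.feature y l (m + i) 0

/-- The number of all kernel entries and biases. -/
def numParams (Φ : ConvNet s d) : ℕ :=
  ∑ l ∈ Finset.range Φ.depth, (Φ.chan (l + 1) * Φ.chan l * s + Φ.chan (l + 1))

open Classical in
/-- The number of nonzero kernel entries and biases. -/
def numNonzero (Φ : ConvNet s d) : ℕ :=
  ∑ l ∈ Finset.range Φ.depth,
    (((Finset.range (Φ.chan (l + 1)) ×ˢ Finset.range (Φ.chan l) ×ˢ Finset.range s).filter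
        fun q => Φ.filter l q.1 q.2.1 q.2.2 ≠ 0).card +
      ((Finset.range (Φ.chan (l + 1))).filter fun o => Φ.bias l o ≠ 0).card)

end ConvNet

end

/-! ### Gathering a signal into the channels, followed by dense layers -/

namespace ConvNet

/-! Each sparse code is recovered by iterative soft thresholding, and one thresholded gradient step
is exactly one ReLU layer: the soft threshold of `z` is `max (z - θ) 0 - max (-z - θ) 0`, and `z` is
affine in the previous layer.

For unit columns, `I - Dᵀ D` has zero diagonal and off-diagonal entries bounded by the coherence
`μ`. If the current iterate is supported in the support of `x`, has `ℓ₁` error at most `b`, and the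
data have `ℓ₁` noise at most `e`, the threshold `μ b + e` kills every coordinate off the support.
Summing over the at most `k` support coordinates gives the new error `(2 k - 1) μ b + 2 k e`; the
`-1` comes from the zero diagonal, and `(2 k - 1) μ < 1` is precisely the uniqueness condition
(`ColumnNormalized.l1norm_softThreshold_gradStep_le`). Hence `K` layers leave the error `q ^ K * B +
G * e` (`l1norm_readAt_stage_le`).

The stages are chained: the estimate of one code is the noisy observation for the next, so its error
is added to that stage's noise (`exists_dense_weights`, `errorBound_le`). The thresholds use only a
priori bounds, so the weights do not depend on the input.

What remains is to make this convolutional. Layers of stride `s` move the signal into the channels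
until its length is one (`feature_gather`); from there, convolutions act as dense layers. -/

theorem feature_succ {s d : ℕ} (Φ : ConvNet s d) (y : Fin d → ℝ) (l c p : ℕ) :
    Φ.feature y (l + 1) c p =
      if c < Φ.chan (l + 1) ∧ p < Φ.width (l + 1) then
        max (∑ i ∈ Finset.range (Φ.chan l), ∑ k ∈ Finset.range s,
          Φ.filter l c i k * Φ.feature y l i (p * Φ.stride l + k) + Φ.bias l c) 0
      else 0 := rfl

/-- The input channel read by output channel `o` of the `l`-th gathering layer. -/
def gatherChan (s d l o : ℕ) : ℕ :=
  if o < min (s ^ (l + 1)) d then o % s ^ l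
  else if l = 0 then 0 else min (s ^ l) d + (o - min (s ^ (l + 1)) d) % s ^ l

/-- The kernel entry used by output channel `o` of the `l`-th gathering layer. -/
def gatherEntry (s d l o : ℕ) : ℕ :=
  if o < min (s ^ (l + 1)) d then o / s ^ l else (o - min (s ^ (l + 1)) d) / s ^ l

/-- The kernels of the gathering layers. -/
noncomputable def gatherFilter (s d l o i k : ℕ) : ℝ :=
  if o < 2 * min (s ^ (l + 1)) d ∧ i = gatherChan s d l o ∧ k = gatherEntry s d l o then
    if l = 0 ∧ min (s ^ (l + 1)) d ≤ o then -1 else 1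
  else 0

/-- The network that first gathers the signal of length `d` into `2 * d` channels (positive and
negative parts) by `Nat.clog s d + 1` layers of stride `s`, and then applies `T` dense layers with
`n` channels, the weights `W` and the biases `β`. -/
noncomputable def gatherDense {s d n : ℕ} (hs : 2 ≤ s) (hd : 1 ≤ d) (hn : 2 * d ≤ n)
    (W : ℕ → ℕ → ℕ → ℝ) (β : ℕ → ℕ → ℝ) (T : ℕ) : ConvNet s d where
  depth := Nat.clog s d + 1 + T
  chan l := if l = 0 then 1 else if l ≤ Nat.clog s d then 2 * min (s ^ l) d else n
  chan_zero := by simp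
  chan_pos l := by
    have : 1 ≤ s ^ l := Nat.one_le_pow _ _ (by omega)
    split_ifs <;> omega
  stride l := if l ≤ Nat.clog s d then s else 1
  stride_pos l := by split_ifs <;> omega
  filter l o i k :=
    if l ≤ Nat.clog s d then gatherFilter s d l o i k
    else if k = 0 then W (l - (Nat.clog s d + 1)) o i else 0
  bias l o := if l ≤ Nat.clog s d then 0 else β (l - (Nat.clog s d + 1)) o

section gatherDense

variable {s d n : ℕ} (hs : 2 ≤ s) (hd : 1 ≤ d) (hn : 2 * d ≤ n)
  (W : ℕ → ℕ → ℕ → ℝ) (β : ℕ → ℕ → ℝ) (T : ℕ)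

/-- Rounding up never loses entries of the signal. This makes the final length at least one and
makes positions beyond the width correspond to indices beyond `d`. -/
theorem le_width_mul_pow (l : ℕ) (hl : l ≤ Nat.clog s d + 1) :
    d ≤ (gatherDense hs hd hn W β T).width l * s ^ l := by
  induction l with
  | zero => simp [width]
  | succ l ih =>
    have h1 := ih (by omega)
    have h2 : (gatherDense hs hd hn W β T).stride l = s := by
      simp [gatherDense]; omega
    have h3 : (gatherDense hs hd hn W β T).width l ≤
        s * ((gatherDense hs hd hn W β T).width (l + 1)) := by
      rw [width, h2]
      exact (ceilDiv_le_iff_le_mul (by omega : 0 < s)).1 le_rfl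
    calc d ≤ _ := h1
      _ ≤ s * ((gatherDense hs hd hn W β T).width (l + 1)) * s ^ l := by gcongr
      _ = _ := by ring

theorem width_le_pow (l : ℕ) (hl : l ≤ Nat.clog s d) :
    (gatherDense hs hd hn W β T).width l ≤ s ^ (Nat.clog s d - l) := by
  induction l with
  | zero => simpa [width] using Nat.le_pow_clog (by omega) d
  | succ l ih =>
    have h1 := ih (by omega)
    have h2 : (gatherDense hs hd hn W β T).stride l = s := by
      simp [gatherDense]; omega
    rw [width, h2]
    refine (ceilDiv_le_iff_le_mul (by omega : 0 < s)).2 (h1.trans_eq ?_)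
    rw [← pow_succ']
    congr 1
    omega

theorem width_gatherDense (t : ℕ) :
    (gatherDense hs hd hn W β T).width (Nat.clog s d + 1 + t) = 1 := by
  induction t with
  | zero =>
    -- `Nat.clog s d` layers already bring the length down to one; the extra layer guarantees that
    -- even for `d = 1` some layer splits the input into positive and negative parts.
    apply le_antisymm
    · have h1 := width_le_pow hs hd hn W β T _ le_rfl
      have h2 : (gatherDense hs hd hn W β T).stride (Nat.clog s d) = s := by simp [gatherDense]
      rw [add_zero, width, h2]
      refine (ceilDiv_le_iff_le_mul (by omega : 0 < s)).2 (h1.trans ?_)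
      simp; omega
    · have h := le_width_mul_pow hs hd hn W β T _ le_rfl
      by_contra hc
      have : (gatherDense hs hd hn W β T).width (Nat.clog s d + 1 + 0) = 0 := by omega
      rw [add_zero] at this
      rw [this] at h
      omega
  | succ t ih =>
    have h2 : (gatherDense hs hd hn W β T).stride (Nat.clog s d + 1 + t) = 1 := by
      simp [gatherDense]; omega
    rw [← add_assoc, width, h2, ih]
    simp

theorem chan_gatherDense (t : ℕ) :
    (gatherDense hs hd hn W β T).chan (Nat.clog s d + 1 + t) = n := by
  simp [gatherDense]; omega

/-- The input signal, extended by zero. -/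
def extendZero (y : Fin d → ℝ) (q : ℕ) : ℝ := if h : q < d then y ⟨q, h⟩ else 0

theorem gatherChan_lt (l o : ℕ) (ho : o < 2 * min (s ^ (l + 1)) d) (hl : l ≤ Nat.clog s d) :
    gatherChan s d l o < (gatherDense hs hd hn W β T).chan l := by
  have hp : 0 < s ^ l := by positivity
  simp only [gatherDense, gatherChan, hl, if_true]
  rcases Nat.eq_zero_or_pos l with rfl | h
  · simp [Nat.mod_one]
  · have h1 := Nat.mod_lt o hp
    have h2 := Nat.mod_lt (o - min (s ^ (l + 1)) d) hp
    have h3 := Nat.mod_le o (s ^ l)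
    have h4 := Nat.mod_le (o - min (s ^ (l + 1)) d) (s ^ l)
    split_ifs <;> omega

theorem gatherEntry_lt (hs : 2 ≤ s) (l o : ℕ) (ho : o < 2 * min (s ^ (l + 1)) d) :
    gatherEntry s d l o < s := by
  have hp : 0 < s ^ l := by positivity
  unfold gatherEntry
  have h : s ^ (l + 1) = s * s ^ l := by ring
  split_ifs <;> rw [Nat.div_lt_iff_lt_mul hp, ← h] <;> omega

theorem feature_gather_succ (y : Fin d → ℝ) (l : ℕ) (hl : l ≤ Nat.clog s d) (o p : ℕ)
    (ho : o < 2 * min (s ^ (l + 1)) d)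
    (hp : p < (gatherDense hs hd hn W β T).width (l + 1)) :
    (gatherDense hs hd hn W β T).feature y (l + 1) o p =
      max ((if l = 0 ∧ min (s ^ (l + 1)) d ≤ o then -1 else 1) *
        (gatherDense hs hd hn W β T).feature y l (gatherChan s d l o)
          (p * s + gatherEntry s d l o)) 0 := by
  have hc : o < (gatherDense hs hd hn W β T).chan (l + 1) := by
    simp only [gatherDense]
    rw [if_neg (by omega)]
    split_ifs <;> omega
  have hst : (gatherDense hs hd hn W β T).stride l = s := by simp [gatherDense, hl]
  have hb : (gatherDense hs hd hn W β T).bias l o = 0 := by simp [gatherDense, hl]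
  have hf : ∀ i k, (gatherDense hs hd hn W β T).filter l o i k = gatherFilter s d l o i k := by
    intro i k; simp [gatherDense, hl]
  rw [feature_succ, if_pos ⟨hc, hp⟩, hst, hb, add_zero]
  congr 1
  rw [Finset.sum_eq_single (gatherChan s d l o), Finset.sum_eq_single (gatherEntry s d l o)]
  · rw [hf, gatherFilter, if_pos ⟨ho, rfl, rfl⟩]
  · intro k _ hk
    rw [hf, gatherFilter, if_neg (by tauto), zero_mul]
  · intro h
    exact absurd (Finset.mem_range.2 (gatherEntry_lt hs l o ho)) h
  · intro i _ hi
    refine Finset.sum_eq_zero fun k _ => ?_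
    rw [hf, gatherFilter, if_neg (by tauto), zero_mul]
  · intro h
    exact absurd (Finset.mem_range.2 (gatherChan_lt hs hd hn W β T l o ho hl)) h

/-- Zero padding agrees with extending the signal by zero, so the invariant of `feature_gather`
needs no restriction on the position `p`. -/
theorem feature_gather_of_width_le (y : Fin d → ℝ) (l : ℕ) (hl : l ≤ Nat.clog s d + 1) (c o p : ℕ)
    (hl0 : l ≠ 0) (hp : (gatherDense hs hd hn W β T).width l ≤ p) :
    (gatherDense hs hd hn W β T).feature y l o p = 0 ∧ extendZero y (p * s ^ l + c) = 0 := by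
  constructor
  · obtain ⟨l, rfl⟩ := Nat.exists_eq_add_one_of_ne_zero hl0
    rw [feature_succ, if_neg (by omega)]
  · have h := le_width_mul_pow hs hd hn W β T l hl
    have h2 : (gatherDense hs hd hn W β T).width l * s ^ l ≤ p * s ^ l := by gcongr
    rw [extendZero, dif_neg (by omega)]

/-- Channel and position act as base-`s` digits of the original index: a stride-`s` layer moves one
digit from the position into the channel. Only the first layer uses the weight `-1`; afterwards both
halves are nonnegative and pass through the ReLU unchanged. -/
theorem feature_gather (y : Fin d → ℝ) (l : ℕ) (hl : l ≤ Nat.clog s d) (c p : ℕ)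
    (hc : c < min (s ^ (l + 1)) d) :
    (gatherDense hs hd hn W β T).feature y (l + 1) c p
        = max (extendZero y (p * s ^ (l + 1) + c)) 0 ∧
      (gatherDense hs hd hn W β T).feature y (l + 1) (min (s ^ (l + 1)) d + c) p
        = max (-extendZero y (p * s ^ (l + 1) + c)) 0 := by
  induction l generalizing c p with
  | zero =>
    by_cases hp : p < (gatherDense hs hd hn W β T).width (0 + 1)
    · rw [feature_gather_succ hs hd hn W β T y 0 hl c p (by omega) hp,
        feature_gather_succ hs hd hn W β T y 0 hl _ p (by omega) hp]
      have h0 : ∀ q, (gatherDense hs hd hn W β T).feature y 0 0 q = extendZero y q := by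
        intro q
        simp [feature, extendZero]
      have e1 : ∀ o, gatherChan s d 0 o = 0 := by simp [gatherChan, Nat.mod_one]
      have e2 : gatherEntry s d 0 c = c := by rw [gatherEntry, if_pos hc]; simp
      have e3 : gatherEntry s d 0 (min (s ^ (0 + 1)) d + c) = c := by
        rw [gatherEntry, if_neg (by omega)]; simp
      rw [e1, e1, e2, e3, h0, if_neg (by omega), if_pos ⟨rfl, by omega⟩]
      simp
    · have h := fun o => feature_gather_of_width_le hs hd hn W β T y (0 + 1) (by omega) c o p
        (by omega) (by omega)
      rw [(h c).1, (h _).1, (h c).2]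
      simp
  | succ l ih =>
    by_cases hp : p < (gatherDense hs hd hn W β T).width (l + 1 + 1)
    · rw [feature_gather_succ hs hd hn W β T y (l + 1) hl c p (by omega) hp,
        feature_gather_succ hs hd hn W β T y (l + 1) hl _ p (by omega) hp]
      have hpos : 0 < s ^ (l + 1) := by positivity
      have h1 : c % s ^ (l + 1) < min (s ^ (l + 1)) d := by
        have := Nat.mod_lt c hpos
        have := Nat.mod_le c (s ^ (l + 1))
        omega
      -- The index identity behind `gatherChan` and `gatherEntry`: remainder and quotient of `c` by
      -- `s ^ (l + 1)` select the input channel and the kernel entry.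
      have h2 : (p * s + c / s ^ (l + 1)) * s ^ (l + 1) + c % s ^ (l + 1)
          = p * s ^ (l + 1 + 1) + c := by
        have := Nat.div_add_mod c (s ^ (l + 1))
        calc _ = p * s ^ (l + 1 + 1) + (s ^ (l + 1) * (c / s ^ (l + 1)) + c % s ^ (l + 1)) := by
              ring
          _ = _ := by rw [this]
      have h3 := ih (by omega) (c % s ^ (l + 1)) (p * s + c / s ^ (l + 1)) h1
      rw [h2] at h3
      have e1 : gatherChan s d (l + 1) c = c % s ^ (l + 1) := by simp only [gatherChan, if_pos hc]
      have e2 : gatherEntry s d (l + 1) c = c / s ^ (l + 1) := by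
        simp only [gatherEntry, if_pos hc]
      have e3 : gatherChan s d (l + 1) (min (s ^ (l + 1 + 1)) d + c)
          = min (s ^ (l + 1)) d + c % s ^ (l + 1) := by
        rw [gatherChan, if_neg (by omega), if_neg (by omega), Nat.add_sub_cancel_left]
      have e4 : gatherEntry s d (l + 1) (min (s ^ (l + 1 + 1)) d + c) = c / s ^ (l + 1) := by
        rw [gatherEntry, if_neg (by omega), Nat.add_sub_cancel_left]
      rw [e1, e2, e3, e4, h3.1, h3.2]
      simp
    · have h := fun o => feature_gather_of_width_le hs hd hn W β T y (l + 1 + 1) (by omega) c o p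
        (by omega) (by omega)
      rw [(h c).1, (h _).1, (h c).2]
      simp

theorem feature_gather_last (y : Fin d → ℝ) (i : Fin d) :
    (gatherDense hs hd hn W β T).feature y (Nat.clog s d + 1) i 0 -
      (gatherDense hs hd hn W β T).feature y (Nat.clog s d + 1) (d + i) 0 = y i := by
  have hm : min (s ^ (Nat.clog s d + 1)) d = d := by
    apply min_eq_right
    exact (Nat.le_pow_clog (by omega) d).trans (Nat.pow_le_pow_right (by omega) (by omega))
  have h := feature_gather hs hd hn W β T y _ le_rfl i 0 (by rw [hm]; exact i.2)
  rw [hm] at h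
  rw [h.1, h.2]
  simp only [zero_mul, zero_add, extendZero, i.2, dif_pos]
  rcases le_total 0 (y i) with h | h <;> simp [h]

theorem feature_dense_succ (y : Fin d → ℝ) (t o : ℕ) (ho : o < n) :
    (gatherDense hs hd hn W β T).feature y (Nat.clog s d + 1 + (t + 1)) o 0 =
      max (∑ i ∈ Finset.range n,
        W t o i * (gatherDense hs hd hn W β T).feature y (Nat.clog s d + 1 + t) i 0 + β t o) 0 := by
  have h1 := chan_gatherDense hs hd hn W β T (t + 1)
  have h2 := width_gatherDense hs hd hn W β T (t + 1)
  rw [← add_assoc] at h1 h2 ⊢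
  rw [feature_succ, if_pos ⟨by omega, by omega⟩, chan_gatherDense]
  have hf : ∀ i k, (gatherDense hs hd hn W β T).filter (Nat.clog s d + 1 + t) o i k =
      if k = 0 then W t o i else 0 := by
    intro i k
    simp only [gatherDense]
    rw [if_neg (by omega), Nat.add_sub_cancel_left]
  have hb : (gatherDense hs hd hn W β T).bias (Nat.clog s d + 1 + t) o = β t o := by
    simp only [gatherDense]
    rw [if_neg (by omega), Nat.add_sub_cancel_left]
  rw [hb]
  congr 2
  refine Finset.sum_congr rfl fun i _ => ?_
  rw [Finset.sum_eq_single 0]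
  · simp [hf]
  · intro k _ hk
    simp [hf, hk]
  · intro h
    exact absurd (Finset.mem_range.2 (by omega)) h

/-! ### Counting the weights -/

theorem sum_min_pow_le (hs : 2 ≤ s) (hd : 1 ≤ d) :
    ∑ l ∈ Finset.range (Nat.clog s d + 1), min (s ^ l) d ≤ 3 * d := by
  have geo : ∀ L, ∑ l ∈ Finset.range (L + 1), s ^ l ≤ 2 * s ^ L := by
    intro L
    induction L with
    | zero => simp
    | succ L ih =>
      rw [Finset.sum_range_succ, pow_succ]
      nlinarith [Nat.pow_pos (n := L) (show 0 < s by omega)]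
  -- All terms but the last form a geometric sum dominated by twice its largest power, which is
  -- below `d`; the last term is at most `d`. This keeps a logarithmic factor out of the weight
  -- count.
  rw [Finset.sum_range_succ]
  rcases Nat.eq_zero_or_pos (Nat.clog s d) with h | h
  · rw [h]; simp; omega
  · obtain ⟨L, hL⟩ := Nat.exists_eq_succ_of_ne_zero h.ne'
    have h1 : s ^ L < d := Nat.pow_lt_of_lt_clog (by omega)
    have h2 : ∑ l ∈ Finset.range (L + 1), min (s ^ l) d ≤ 2 * s ^ L :=
      (Finset.sum_le_sum fun l _ => min_le_left _ _).trans (geo L)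
    rw [hL, Nat.succ_eq_add_one]
    have := min_le_right (s ^ (L + 1)) d
    omega

theorem clog_add_one_le (hs : 2 ≤ s) (hd : 1 ≤ d) (hn : 2 * d ≤ n) : Nat.clog s d + 1 ≤ n := by
  have : Nat.clog s d ≤ d := Nat.clog_le_of_le_pow (Nat.lt_pow_self (by omega)).le
  omega

theorem chan_gather_le (l : ℕ) (hl : l ≤ Nat.clog s d) :
    (gatherDense hs hd hn W β T).chan l ≤ 2 * min (s ^ l) d := by
  simp only [gatherDense]
  have : 1 ≤ s ^ l := Nat.one_le_pow _ _ (by omega)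
  split_ifs <;> omega

theorem chan_gatherDense_le (l : ℕ) : (gatherDense hs hd hn W β T).chan l ≤ n := by
  simp only [gatherDense]
  split_ifs <;> omega

theorem numParams_gatherDense_le :
    (gatherDense hs hd hn W β T).numParams ≤ 5 * s * n ^ 2 * (T + 1) := by
  have hn1 : 1 ≤ n := by omega
  have hdep : (gatherDense hs hd hn W β T).depth = Nat.clog s d + 1 + T := rfl
  rw [numParams, hdep, Finset.sum_range_add]
  have h1 : ∑ l ∈ Finset.range (Nat.clog s d + 1),
      ((gatherDense hs hd hn W β T).chan (l + 1) * (gatherDense hs hd hn W β T).chan l * s +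
        (gatherDense hs hd hn W β T).chan (l + 1)) ≤ 4 * s * n ^ 2 := by
    calc _ ≤ ∑ l ∈ Finset.range (Nat.clog s d + 1), (n * (2 * min (s ^ l) d) * s + n) := by
          refine Finset.sum_le_sum fun l hl => ?_
          have := chan_gather_le hs hd hn W β T l (by simp at hl; omega)
          have := chan_gatherDense_le hs hd hn W β T (l + 1)
          gcongr
      _ = 2 * n * s * (∑ l ∈ Finset.range (Nat.clog s d + 1), min (s ^ l) d) +
          (Nat.clog s d + 1) * n := by
          rw [Finset.sum_add_distrib, Finset.mul_sum]
          simp only [Finset.sum_const, Finset.card_range, smul_eq_mul]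
          congr 1
          exact Finset.sum_congr rfl fun l _ => by ring
      _ ≤ 2 * n * s * (3 * d) + n * n := by
          gcongr
          · exact sum_min_pow_le hs hd
          · exact clog_add_one_le hs hd hn
      _ = 3 * n * s * (2 * d) + n * n * 1 := by ring
      _ ≤ 3 * n * s * n + n * n * s := by gcongr; omega
      _ = _ := by ring
  have h2 : ∑ l ∈ Finset.range T,
      ((gatherDense hs hd hn W β T).chan (Nat.clog s d + 1 + l + 1) *
        (gatherDense hs hd hn W β T).chan (Nat.clog s d + 1 + l) * s +
        (gatherDense hs hd hn W β T).chan (Nat.clog s d + 1 + l + 1)) ≤ T * (2 * s * n ^ 2) := by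
    calc _ ≤ ∑ l ∈ Finset.range T, (n * n * s + n * 1 * 1) := by
          refine Finset.sum_le_sum fun l _ => ?_
          have := chan_gatherDense_le hs hd hn W β T (Nat.clog s d + 1 + l)
          have := chan_gatherDense_le hs hd hn W β T (Nat.clog s d + 1 + l + 1)
          rw [mul_one, mul_one]
          gcongr
      _ ≤ ∑ l ∈ Finset.range T, (n * n * s + n * n * s) := by
          gcongr; omega
      _ = _ := by simp; left; ring
  calc _ ≤ 4 * s * n ^ 2 + T * (2 * s * n ^ 2) := add_le_add h1 h2
    _ ≤ _ := by nlinarith [Nat.zero_le (s * n ^ 2), Nat.zero_le (T * (s * n ^ 2))]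

theorem numNonzero_gatherDense_le :
    (gatherDense hs hd hn W β T).numNonzero ≤ 2 * n ^ 2 * (T + 1) := by
  classical
  have hn1 : 1 ≤ n := by omega
  have hdep : (gatherDense hs hd hn W β T).depth = Nat.clog s d + 1 + T := rfl
  rw [numNonzero, hdep, Finset.sum_range_add]
  have h1 : ∀ l ∈ Finset.range (Nat.clog s d + 1),
      (((Finset.range ((gatherDense hs hd hn W β T).chan (l + 1)) ×ˢ
        Finset.range ((gatherDense hs hd hn W β T).chan l) ×ˢ Finset.range s).filter
        fun q => (gatherDense hs hd hn W β T).filter l q.1 q.2.1 q.2.2 ≠ 0).card +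
      ((Finset.range ((gatherDense hs hd hn W β T).chan (l + 1))).filter
        fun o => (gatherDense hs hd hn W β T).bias l o ≠ 0).card) ≤ n := by
    intro l hl
    have hl' : l ≤ Nat.clog s d := by simp at hl; omega
    have hb : ∀ o, (gatherDense hs hd hn W β T).bias l o = 0 := by
      intro o; simp [gatherDense, hl']
    have hf : ∀ o i k,
        (gatherDense hs hd hn W β T).filter l o i k = gatherFilter s d l o i k := by
      intro o i k; simp [gatherDense, hl']
    simp only [hb, hf, ne_eq, not_true, Finset.filter_false, Finset.card_empty, add_zero]
    refine le_trans ?_ (chan_gatherDense_le hs hd hn W β T (l + 1))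
    conv_rhs => rw [← Finset.card_range ((gatherDense hs hd hn W β T).chan (l + 1))]
    -- A gathering kernel has at most one nonzero entry per output channel.
    refine Finset.card_le_card_of_injOn (fun q => q.1) ?_ ?_
    · intro q hq
      simp only [Finset.mem_coe, Finset.mem_filter, Finset.mem_product] at hq
      exact hq.1.1
    · rintro ⟨o, i, k⟩ hq ⟨o', i', k'⟩ hq' h
      change o = o' at h
      subst h
      have hq2 := (Finset.mem_filter.1 hq).2
      have hq2' := (Finset.mem_filter.1 hq').2
      simp only [gatherFilter] at hq2 hq2'
      have e1 := (Classical.not_not.1 fun hc => hq2 (if_neg hc)).2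
      have e2 := (Classical.not_not.1 fun hc => hq2' (if_neg hc)).2
      simp [e1.1, e1.2, e2.1, e2.2]
  have h2 : ∀ t ∈ Finset.range T,
      (((Finset.range ((gatherDense hs hd hn W β T).chan (Nat.clog s d + 1 + t + 1)) ×ˢ
        Finset.range ((gatherDense hs hd hn W β T).chan (Nat.clog s d + 1 + t)) ×ˢ
          Finset.range s).filter fun q =>
          (gatherDense hs hd hn W β T).filter (Nat.clog s d + 1 + t) q.1 q.2.1 q.2.2 ≠ 0).card +
      ((Finset.range ((gatherDense hs hd hn W β T).chan (Nat.clog s d + 1 + t + 1))).filter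
        fun o => (gatherDense hs hd hn W β T).bias (Nat.clog s d + 1 + t) o ≠ 0).card)
        ≤ n * n + n := by
    intro t _
    refine add_le_add ?_ ?_
    · calc _ ≤ (Finset.range n ×ˢ Finset.range n ×ˢ Finset.range 1).card := by
            refine Finset.card_le_card fun q hq => ?_
            simp only [Finset.mem_filter, Finset.mem_product, Finset.mem_range] at hq ⊢
            have := chan_gatherDense_le hs hd hn W β T (Nat.clog s d + 1 + t)
            have := chan_gatherDense_le hs hd hn W β T (Nat.clog s d + 1 + t + 1)
            refine ⟨by omega, by omega, ?_⟩
            by_contra hk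
            apply hq.2
            simp only [gatherDense]
            rw [if_neg (by omega), if_neg (by omega)]
        _ = n * n := by simp
    · refine (Finset.card_filter_le _ _).trans ?_
      rw [Finset.card_range]
      exact chan_gatherDense_le hs hd hn W β T _
  calc _ ≤ (Nat.clog s d + 1) * n + T * (n * n + n) := by
        refine add_le_add ?_ ?_
        · simpa using Finset.sum_le_card_nsmul _ _ _ h1
        · simpa using Finset.sum_le_card_nsmul _ _ _ h2
    _ ≤ n * n + T * (n * n + n * n) := by
        gcongr
        · exact clog_add_one_le hs hd hn
        · exact Nat.le_mul_of_pos_left _ hn1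
    _ ≤ _ := by nlinarith [Nat.zero_le (n ^ 2)]

end gatherDense

end ConvNet

/-! ### Coherence and soft thresholding -/

/-- Soft thresholding. -/
noncomputable def softThreshold (θ z : ℝ) : ℝ := max (z - θ) 0 - max (-z - θ) 0

theorem softThreshold_eq_zero {θ z : ℝ} (h : |z| ≤ θ) : softThreshold θ z = 0 := by
  rw [abs_le] at h
  rw [softThreshold, max_eq_right (by linarith), max_eq_right (by linarith), sub_zero]

theorem abs_softThreshold_sub_le {θ : ℝ} (hθ : 0 ≤ θ) (z : ℝ) : |softThreshold θ z - z| ≤ θ := by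
  rw [softThreshold, abs_le]
  rcases max_cases (z - θ) 0 with ⟨h1, h1'⟩ | ⟨h1, h1'⟩ <;>
    rcases max_cases (-z - θ) 0 with ⟨h2, h2'⟩ | ⟨h2, h2'⟩ <;> rw [h1, h2] <;>
    constructor <;> linarith

theorem l2norm_sq {ι : Type*} [Fintype ι] (v : ι → ℝ) : l2norm v ^ 2 = ∑ i, v i ^ 2 := by
  rw [l2norm, EuclideanSpace.norm_sq_eq]
  simp

theorem l2norm_le_l1norm {ι : Type*} [Fintype ι] (v : ι → ℝ) : l2norm v ≤ l1norm v := by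
  have h1 : 0 ≤ l1norm v := Finset.sum_nonneg fun _ _ => abs_nonneg _
  refine le_of_sq_le_sq ?_ h1
  rw [l2norm_sq, l1norm]
  calc ∑ i, v i ^ 2 = ∑ i, |v i| ^ 2 := by simp
    _ ≤ _ := Finset.sum_sq_le_sq_sum_of_nonneg fun _ _ => abs_nonneg _

theorem l1norm_add_le {ι : Type*} [Fintype ι] (v w : ι → ℝ) :
    l1norm (v + w) ≤ l1norm v + l1norm w := by
  rw [l1norm, l1norm, l1norm, ← Finset.sum_add_distrib]
  exact Finset.sum_le_sum fun i _ => abs_add_le _ _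

section Dictionary

variable {m d : ℕ} {D : Matrix (Fin m) (Fin d) ℝ}

theorem mutualCoherence_nonneg : 0 ≤ mutualCoherence D :=
  Real.iSup_nonneg fun _ => div_nonneg (abs_nonneg _) (mul_nonneg (norm_nonneg _) (norm_nonneg _))

theorem ColumnNormalized.abs_gram_le (hD : ColumnNormalized D) {i j : Fin d} (hij : i ≠ j) :
    |(Dᵀ * D) i j| ≤ mutualCoherence D := by
  have h : |(fun k => D k i) ⬝ᵥ (fun k => D k j)| /
      (l2norm (fun k => D k i) * l2norm (fun k => D k j)) ≤ _ :=
    le_ciSup (f := fun p : {p : Fin d × Fin d // p.1 ≠ p.2} =>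
    |(fun i => D i p.1.1) ⬝ᵥ (fun i => D i p.1.2)| /
      (l2norm (fun i => D i p.1.1) * l2norm (fun i => D i p.1.2))) (Set.finite_range _).bddAbove
      ⟨(i, j), hij⟩
  rw [hD i, hD j, mul_one, div_one] at h
  exact h

theorem ColumnNormalized.gram_diag (hD : ColumnNormalized D) (i : Fin d) : (Dᵀ * D) i i = 1 := by
  have h := l2norm_sq (fun k => D k i)
  rw [hD i] at h
  simp only [Matrix.mul_apply, Matrix.transpose_apply]
  rw [← one_pow 2, h]
  exact Finset.sum_congr rfl fun k _ => (sq _).symm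

theorem ColumnNormalized.abs_entry_le (hD : ColumnNormalized D) (k : Fin m) (i : Fin d) :
    |D k i| ≤ 1 := by
  have h := l2norm_sq (fun k => D k i)
  rw [hD i] at h
  have := Finset.single_le_sum (f := fun k => D k i ^ 2) (fun _ _ => sq_nonneg _)
    (Finset.mem_univ k)
  rw [abs_le_one_iff_mul_self_le_one]
  nlinarith

theorem ColumnNormalized.abs_transpose_mulVec_le (hD : ColumnNormalized D) (e : Fin m → ℝ)
    (i : Fin d) : |(Dᵀ *ᵥ e) i| ≤ l1norm e := by
  simp only [Matrix.mulVec, dotProduct, Matrix.transpose_apply]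
  refine (Finset.abs_sum_le_sum_abs _ _).trans (Finset.sum_le_sum fun k _ => ?_)
  rw [abs_mul]
  exact mul_le_of_le_one_left (abs_nonneg _) (hD.abs_entry_le k i)

/-- The gradient step `z = x' + Dᵀ (v - D x')`. -/
noncomputable def gradStep (D : Matrix (Fin m) (Fin d) ℝ) (v : Fin m → ℝ) (x' : Fin d → ℝ) :
    Fin d → ℝ := x' + Dᵀ *ᵥ (v - D *ᵥ x')

theorem ColumnNormalized.abs_gradStep_sub_le (hD : ColumnNormalized D) (v : Fin m → ℝ)
    (x x' : Fin d → ℝ) (i : Fin d) :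
    |gradStep D v x' i - x i| ≤
      mutualCoherence D * (l1norm (x' - x) - |x' i - x i|) + l1norm (v - D *ᵥ x) := by
  -- The error is `(I - Dᵀ D) (x' - x)` plus the back-projected noise; the unit diagonal of the Gram
  -- matrix cancels the `i`-th error in coordinate `i`.
  have e1 : gradStep D v x' - x = (x' - x) - (Dᵀ * D) *ᵥ (x' - x) + Dᵀ *ᵥ (v - D *ᵥ x) := by
    rw [gradStep, ← Matrix.mulVec_mulVec]
    simp only [Matrix.mulVec_sub]
    abel
  have e2 : gradStep D v x' i - x i
      = -(∑ j ∈ Finset.univ.erase i, (Dᵀ * D) i j * (x' - x) j) + (Dᵀ *ᵥ (v - D *ᵥ x)) i := by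
    have := congrFun e1 i
    simp only [Pi.add_apply, Pi.sub_apply] at this
    rw [this]
    congr 1
    rw [Matrix.mulVec, dotProduct, ← Finset.add_sum_erase _ _ (Finset.mem_univ i), hD.gram_diag]
    simp
  rw [e2]
  refine (abs_add_le _ _).trans (add_le_add ?_ (hD.abs_transpose_mulVec_le _ i))
  rw [abs_neg]
  have e3 : l1norm (x' - x) - |x' i - x i| = ∑ j ∈ Finset.univ.erase i, |(x' - x) j| := by
    rw [l1norm, ← Finset.add_sum_erase _ _ (Finset.mem_univ i)]
    simp
  rw [e3, Finset.mul_sum]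
  refine (Finset.abs_sum_le_sum_abs _ _).trans (Finset.sum_le_sum fun j hj => ?_)
  rw [abs_mul]
  exact mul_le_mul_of_nonneg_right (hD.abs_gram_le (Finset.ne_of_mem_erase hj).symm) (abs_nonneg _)

/-- One thresholded gradient step contracts the `ℓ₁` error of a sparse vector. -/
theorem ColumnNormalized.l1norm_softThreshold_gradStep_le (hD : ColumnNormalized D) {k : ℕ} {q : ℝ}
    (hq : 0 ≤ q) (hkq : (2 * (k : ℝ) - 1) * mutualCoherence D ≤ q) {v : Fin m → ℝ}
    {x x' : Fin d → ℝ} (hx : l0norm x ≤ k) (hsupp : ∀ i, x i = 0 → x' i = 0) {b e : ℝ}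
    (hb : l1norm (x' - x) ≤ b)
    (he : l1norm (v - D *ᵥ x) ≤ e) :
    l1norm ((fun i => softThreshold (mutualCoherence D * b + e) (gradStep D v x' i)) - x) ≤
        q * b + 2 * k * e ∧
      ∀ i, x i = 0 → softThreshold (mutualCoherence D * b + e) (gradStep D v x' i) = 0 := by
  classical
  set μ := mutualCoherence D with hμ
  have hμ0 : 0 ≤ μ := mutualCoherence_nonneg
  have hb0 : 0 ≤ b := (Finset.sum_nonneg fun _ _ => abs_nonneg _).trans hb
  have he0 : 0 ≤ e := (Finset.sum_nonneg fun _ _ => abs_nonneg _).trans he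
  have hg := hD.abs_gradStep_sub_le v x x'
  have hθ : 0 ≤ μ * b + e := by positivity
  set S := Finset.univ.filter fun i => x i ≠ 0 with hS
  have hcard : S.card ≤ k := by
    refine le_trans (le_of_eq ?_) hx
    rw [l0norm, hS]
  have hoff : ∀ i, x i = 0 → softThreshold (μ * b + e) (gradStep D v x' i) = 0 := by
    intro i hxi
    apply softThreshold_eq_zero
    have h1 := hg i
    rw [hxi, sub_zero, sub_zero] at h1
    have h2 : μ * (l1norm (x' - x) - |x' i|) ≤ μ * b :=
      mul_le_mul_of_nonneg_left (by linarith [abs_nonneg (x' i)]) hμ0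
    linarith
  refine ⟨?_, hoff⟩
  -- The bias of the threshold costs another `μ * b + e`. The subtracted term is kept: summed over
  -- the support it gives the `-1` in `2 * k - 1`.
  have hon : ∀ i ∈ S, |softThreshold (μ * b + e) (gradStep D v x' i) - x i| ≤
      (μ * l1norm (x' - x) + μ * b + 2 * e) - μ * |x' i - x i| := by
    intro i _
    have h1 := abs_softThreshold_sub_le hθ (gradStep D v x' i)
    have h2 := hg i
    have h3 := abs_sub_le (softThreshold (μ * b + e) (gradStep D v x' i)) (gradStep D v x' i) (x i)
    linarith
  have hrestrict : ∀ f : Fin d → ℝ, (∀ i, x i = 0 → f i = 0) → ∑ i ∈ S, f i = ∑ i, f i := by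
    intro f hf
    refine Finset.sum_subset (Finset.subset_univ _) fun i _ hi => hf i ?_
    simpa [hS] using hi
  have h1 : l1norm (x' - x) = ∑ i ∈ S, |x' i - x i| :=
    (hrestrict (fun i => |x' i - x i|) fun i hi => by simp [hi, hsupp i hi]).symm
  have h2 : l1norm ((fun i => softThreshold (μ * b + e) (gradStep D v x' i)) - x) =
      ∑ i ∈ S, |softThreshold (μ * b + e) (gradStep D v x' i) - x i| :=
    (hrestrict (fun i => |softThreshold (μ * b + e) (gradStep D v x' i) - x i|)
      fun i hi => by simp [hi, hoff i hi]).symm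
  rw [h2]
  have h3 := Finset.sum_le_sum hon
  rw [Finset.sum_sub_distrib, ← Finset.mul_sum, ← h1, Finset.sum_const, nsmul_eq_mul] at h3
  refine h3.trans ?_
  have hk : (S.card : ℝ) ≤ k := by exact_mod_cast hcard
  have hke : (S.card : ℝ) * e ≤ k * e := mul_le_mul_of_nonneg_right hk he0
  -- With empty support the factor `S.card - 1` is negative, so the actual error cannot be replaced
  -- by `b` there; but then the error is zero.
  rcases S.card.eq_zero_or_pos with h0 | h0
  · have hl : l1norm (x' - x) = 0 := by
      rw [h1, Finset.card_eq_zero.1 h0, Finset.sum_empty]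
    rw [hl, h0]
    simp
    positivity
  · have h0' : (1 : ℝ) ≤ S.card := by exact_mod_cast h0
    have h4 : ((S.card : ℝ) - 1) * μ * l1norm (x' - x) ≤ ((S.card : ℝ) - 1) * μ * b :=
      mul_le_mul_of_nonneg_left hb (mul_nonneg (by linarith) hμ0)
    have h5 : (2 * (S.card : ℝ) - 1) * μ * b ≤ q * b := by
      refine mul_le_mul_of_nonneg_right (le_trans ?_ hkq) hb0
      exact mul_le_mul_of_nonneg_right (by linarith) hμ0
    linarith

/-- A sparsity level that dominates all levels allowed by the uniqueness condition. -/
theorem exists_sparsity_level (D : Matrix (Fin m) (Fin d) ℝ) :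
    ∃ k : ℕ, (2 * (k : ℝ) - 1) * mutualCoherence D < 1 ∧
      ∀ (lam : ℝ) (x : Fin d → ℝ), UniquenessCondition D lam → (l0norm x : ℝ) ≤ lam →
        l0norm x ≤ k := by
  classical
  have hμ0 : 0 ≤ mutualCoherence D := mutualCoherence_nonneg
  refine ⟨Nat.findGreatest (fun k : ℕ => (2 * (k : ℝ) - 1) * mutualCoherence D < 1) d, ?_, ?_⟩
  · refine Nat.findGreatest_spec (P := fun k : ℕ => (2 * (k : ℝ) - 1) * mutualCoherence D < 1)
      (Nat.zero_le d) ?_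
    simp; linarith
  · intro lam x hu hx
    refine Nat.le_findGreatest ?_ ?_
    · exact (Finset.card_filter_le _ _).trans (by simp)
    · rcases hμ0.eq_or_lt with h | h
      · rw [← h]; simp
      · have h1 := hu h
        have h2 : 2 * (l0norm x : ℝ) - 1 < 1 / mutualCoherence D := by linarith
        rwa [lt_div_iff₀ h] at h2

end Dictionary

/-! ### Dense layers performing thresholded gradient steps -/

/-- The functional `ℓ` is a linear combination of the first `n` coordinates. -/
def IsRow (n : ℕ) (ℓ : (ℕ → ℝ) → ℝ) : Prop :=
  ∃ w : ℕ → ℝ, ∀ u, ℓ u = ∑ i ∈ Finset.range n, w i * u i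

namespace IsRow

variable {n : ℕ} {f g : (ℕ → ℝ) → ℝ}

theorem coord {i : ℕ} (hi : i < n) : IsRow n fun u => u i :=
  ⟨fun k => if k = i then 1 else 0, fun u => by simp [hi]⟩

theorem zero : IsRow n fun _ => 0 := ⟨0, fun u => by simp⟩

theorem add (hf : IsRow n f) (hg : IsRow n g) : IsRow n fun u => f u + g u := by
  obtain ⟨v, hv⟩ := hf
  obtain ⟨w, hw⟩ := hg
  exact ⟨v + w, fun u => by simp [hv, hw, add_mul, Finset.sum_add_distrib]⟩

theorem const_mul (hf : IsRow n f) (c : ℝ) : IsRow n fun u => c * f u := by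
  obtain ⟨v, hv⟩ := hf
  exact ⟨fun i => c * v i, fun u => by simp [hv, mul_assoc, Finset.mul_sum]⟩

theorem neg (hf : IsRow n f) : IsRow n fun u => -f u := by
  simpa using hf.const_mul (-1)

theorem sub (hf : IsRow n f) (hg : IsRow n g) : IsRow n fun u => f u - g u := by
  simpa [sub_eq_add_neg] using hf.add hg.neg

theorem sum {ι : Type*} (s : Finset ι) {f : ι → (ℕ → ℝ) → ℝ} (hf : ∀ i, IsRow n (f i)) :
    IsRow n fun u => ∑ i ∈ s, f i u := by
  classical
  induction s using Finset.induction_on with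
  | empty => simpa using zero
  | insert a s ha ih => simpa [Finset.sum_insert ha] using (hf a).add ih

end IsRow

section Stage

variable {a b : ℕ}

/-- The vector stored as a difference of the channels `p, …, p + m - 1` and
`p + m, …, p + 2 * m - 1`. -/
def readAt (p m : ℕ) (u : ℕ → ℝ) : Fin m → ℝ := fun i => u (p + i) - u (p + m + i)

/-- The observation read by the `k`-th step. -/
def readObs (a b k : ℕ) (u : ℕ → ℝ) : Fin a → ℝ := readAt (if k = 0 then 0 else 2 * b) a u

/-- The code read by the `k`-th step. -/
def readCode (b k : ℕ) (u : ℕ → ℝ) : Fin b → ℝ := if k = 0 then 0 else readAt 0 b u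

/-- The values, before applying the ReLU, of the layer performing the `k`-th thresholded gradient
step. The code occupies the first `2 * b` channels, the observation the next `2 * a` ones. -/
noncomputable def preStep (D : Matrix (Fin a) (Fin b) ℝ) (θ : ℝ) (k : ℕ) (u : ℕ → ℝ) (o : ℕ) : ℝ :=
  if h : o < b then gradStep D (readObs a b k u) (readCode b k u) ⟨o, h⟩ - θ
  else if h : o - b < b then -gradStep D (readObs a b k u) (readCode b k u) ⟨o - b, h⟩ - θ
  else if h : o - 2 * b < a then readObs a b k u ⟨o - 2 * b, h⟩
  else if h : o - (2 * b + a) < a then -readObs a b k u ⟨o - (2 * b + a), h⟩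
  else 0

variable {n : ℕ}

theorem isRow_readObs (hn : 2 * (a + b) ≤ n) (k : ℕ) (i : Fin a) :
    IsRow n fun u => readObs a b k u i := by
  unfold readObs readAt
  refine (IsRow.coord ?_).sub (IsRow.coord ?_) <;> split_ifs <;> omega

theorem isRow_readCode (hn : 2 * (a + b) ≤ n) (k : ℕ) (i : Fin b) :
    IsRow n fun u => readCode b k u i := by
  unfold readCode readAt
  by_cases hk : k = 0
  · simpa [hk] using IsRow.zero
  · simp only [hk, if_false]
    exact (IsRow.coord (by omega)).sub (IsRow.coord (by omega))

theorem isRow_gradStep (hn : 2 * (a + b) ≤ n) (D : Matrix (Fin a) (Fin b) ℝ) (k : ℕ) (i : Fin b) :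
    IsRow n fun u => gradStep D (readObs a b k u) (readCode b k u) i := by
  simp only [gradStep, Pi.add_apply, Matrix.mulVec, dotProduct, Pi.sub_apply]
  exact (isRow_readCode hn k i).add (IsRow.sum _ fun j => ((isRow_readObs hn k j).sub
    (IsRow.sum _ fun l => (isRow_readCode hn k l).const_mul _)).const_mul _)

/-- The weights and the bias are chosen before `u`, which is what makes the step a fixed dense
layer. -/
theorem exists_preStep_eq (hn : 2 * (a + b) ≤ n) (D : Matrix (Fin a) (Fin b) ℝ) (θ : ℝ)
    (k o : ℕ) :
    ∃ (w : ℕ → ℝ) (β : ℝ), ∀ u, preStep D θ k u o = ∑ i ∈ Finset.range n, w i * u i + β := by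
  have aux : ∀ (ℓ : (ℕ → ℝ) → ℝ) (β : ℝ), IsRow n ℓ → (∀ u, preStep D θ k u o = ℓ u + β) →
      ∃ (w : ℕ → ℝ) (β : ℝ), ∀ u, preStep D θ k u o = ∑ i ∈ Finset.range n, w i * u i + β := by
    rintro ℓ β ⟨w, hw⟩ h
    exact ⟨w, β, fun u => by rw [h, hw]⟩
  by_cases h1 : o < b
  · exact aux _ (-θ) (isRow_gradStep hn D k ⟨o, h1⟩) fun u => by
      rw [preStep, dif_pos h1, sub_eq_add_neg]
  by_cases h2 : o - b < b
  · exact aux _ (-θ) (isRow_gradStep hn D k ⟨o - b, h2⟩).neg fun u => by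
      rw [preStep, dif_neg h1, dif_pos h2, sub_eq_add_neg]
  by_cases h3 : o - 2 * b < a
  · exact aux _ 0 (isRow_readObs hn k ⟨o - 2 * b, h3⟩) fun u => by
      rw [preStep, dif_neg h1, dif_neg h2, dif_pos h3, add_zero]
  by_cases h4 : o - (2 * b + a) < a
  · exact aux _ 0 (isRow_readObs hn k ⟨o - (2 * b + a), h4⟩).neg fun u => by
      rw [preStep, dif_neg h1, dif_neg h2, dif_neg h3, dif_pos h4, add_zero]
  · exact aux _ 0 IsRow.zero fun u => by
      rw [preStep, dif_neg h1, dif_neg h2, dif_neg h3, dif_neg h4, add_zero]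

variable {D : Matrix (Fin a) (Fin b) ℝ} {θ : ℝ} {k : ℕ} {u u' : ℕ → ℝ}

/-- The observation survives the ReLU because `max r 0 - max (-r) 0 = r`. The first step reads it
from the front channels, where the previous stage leaves its output; later steps read it behind the
code. -/
theorem readObs_step (hn : 2 * (a + b) ≤ n)
    (hu : ∀ o < n, u' o = max (preStep D θ k u o) 0) : readObs a b (k + 1) u' = readObs a b k u := by
  funext i
  have h1 : preStep D θ k u (2 * b + i) = readObs a b k u i := by
    rw [preStep, dif_neg (by omega), dif_neg (by omega), dif_pos (by omega)]
    congr 1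
    ext; simp
  have h2 : preStep D θ k u (2 * b + a + i) = -readObs a b k u i := by
    rw [preStep, dif_neg (by omega), dif_neg (by omega), dif_neg (by omega), dif_pos (by omega)]
    congr 2
    ext; simp
  rw [readObs, if_neg (by omega), readAt, hu _ (by omega), hu _ (by omega), h1, h2]
  rcases le_total 0 (readObs a b k u i) with h | h <;> simp [h]

theorem readCode_step (hn : 2 * (a + b) ≤ n)
    (hu : ∀ o < n, u' o = max (preStep D θ k u o) 0) : readCode b (k + 1) u' =
    fun i => softThreshold θ (gradStep D (readObs a b k u) (readCode b k u) i) := by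
  funext i
  have h1 : preStep D θ k u (0 + i) = gradStep D (readObs a b k u) (readCode b k u) i - θ := by
    rw [preStep, dif_pos (by omega)]
    congr 2
    ext; simp
  have h2 : preStep D θ k u (0 + b + i) = -gradStep D (readObs a b k u) (readCode b k u) i - θ := by
    rw [preStep, dif_neg (by omega), dif_pos (by omega)]
    congr 3
    ext; simp
  rw [readCode, if_neg (by omega), readAt, hu _ (by omega), hu _ (by omega), h1, h2, softThreshold]

end Stage

/-- The threshold of the `k`-th step, for the initial error `B`, the noise level `e`, the
contraction factor `q` and the noise amplification `G`. -/
noncomputable def stepThreshold {a b : ℕ} (D : Matrix (Fin a) (Fin b) ℝ) (q B G e : ℝ) (k : ℕ) :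
    ℝ := mutualCoherence D * (q ^ k * B + G * e) + e

/-- The bound `q ^ k * B + G * e` reproduces itself under `b ↦ q * b + 2 * κ * e` because `2 * κ + q
* G ≤ G`. The support condition is carried along the induction and holds initially because the code
starts at zero. -/
theorem l1norm_readAt_stage_le {a b n : ℕ} (hn : 2 * (a + b) ≤ n) {D : Matrix (Fin a) (Fin b) ℝ}
    (hD : ColumnNormalized D) {κ : ℕ} {q B G e : ℝ} (hq : 0 ≤ q) (hG0 : 0 ≤ G)
    (hκq : (2 * (κ : ℝ) - 1) * mutualCoherence D ≤ q) (hG : 2 * κ + q * G ≤ G)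
    {K : ℕ} (hK : 1 ≤ K) {U : ℕ → ℕ → ℝ}
    (hU : ∀ k < K, ∀ o < n, U (k + 1) o = max (preStep D (stepThreshold D q B G e k) k (U k) o) 0)
    {x : Fin b → ℝ} (hx : l0norm x ≤ κ) (hxB : l1norm x ≤ B)
    (he : l1norm (readAt 0 a (U 0) - D *ᵥ x) ≤ e) :
    l1norm (readAt 0 b (U K) - x) ≤ q ^ K * B + G * e := by
  have he0 : 0 ≤ e := (Finset.sum_nonneg fun _ _ => abs_nonneg _).trans he
  have key : ∀ k ≤ K, readObs a b k (U k) = readAt 0 a (U 0) ∧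
      l1norm (readCode b k (U k) - x) ≤ q ^ k * B + G * e ∧
      ∀ i, x i = 0 → readCode b k (U k) i = 0 := by
    intro k hk
    induction k with
    | zero =>
      refine ⟨by simp [readObs], ?_, by simp [readCode]⟩
      have : l1norm (readCode b 0 (U 0) - x) = l1norm x := by simp [readCode, l1norm]
      rw [this, pow_zero, one_mul]
      linarith [mul_nonneg hG0 he0]
    | succ k ih =>
      obtain ⟨i1, i2, i3⟩ := ih (by omega)
      have hs := hU k (by omega)
      have hc := readCode_step hn hs
      rw [← i1] at he
      have := hD.l1norm_softThreshold_gradStep_le hq hκq hx i3 i2 he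
      rw [readObs_step hn hs, hc]
      refine ⟨i1, this.1.trans ?_, this.2⟩
      have := mul_le_mul_of_nonneg_right hG he0
      rw [pow_succ]
      linarith
  have := (key K le_rfl).2.1
  rwa [readCode, if_neg (by omega)] at this

/-! ### The deep network -/

/-- The error bounds after each block of `K` layers. -/
noncomputable def errorBound (r G : ℝ) (δ : ℕ → ℝ) : ℕ → ℝ
  | 0 => 0
  | j + 1 => r + G * (errorBound r G δ j + δ j)

/-- Unrolling the recursion multiplies each contribution by at most `G ^ j`, since `G ≥ 1`. -/
theorem errorBound_le {r G : ℝ} {δ : ℕ → ℝ} (hr : 0 ≤ r) (hG : 1 ≤ G) (hδ : ∀ j, 0 ≤ δ j) (j : ℕ) :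
    errorBound r G δ j ≤ G ^ j * (j * r + ∑ i ∈ Finset.range j, δ i) := by
  induction j with
  | zero => simp [errorBound]
  | succ j ih =>
    rw [errorBound, Finset.sum_range_succ]
    have h1 : G * errorBound r G δ j ≤ G * (G ^ j * (j * r + ∑ i ∈ Finset.range j, δ i)) :=
      mul_le_mul_of_nonneg_left ih (by linarith)
    have h2 : 1 * r ≤ G ^ (j + 1) * r := mul_le_mul_of_nonneg_right (one_le_pow₀ hG) hr
    have h3 : G * δ j ≤ G ^ (j + 1) * δ j :=
      mul_le_mul_of_nonneg_right (le_self_pow₀ hG (by omega)) (hδ j)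
    push_cast
    rw [pow_succ] at *
    linarith

theorem exists_dense_weights {J : ℕ} {d : Fin (J + 1) → ℕ}
    (D : (j : Fin J) → Matrix (Fin (d j.castSucc)) (Fin (d j.succ)) ℝ)
    (hD : ∀ j, ColumnNormalized (D j)) {n : ℕ} (hn : ∀ j : Fin J, 2 * (d j.castSucc + d j.succ) ≤ n)
    {κ : Fin J → ℕ} {q G : ℝ} (hq : 0 ≤ q) (hG0 : 0 ≤ G)
    (hκq : ∀ j, (2 * (κ j : ℝ) - 1) * mutualCoherence (D j) ≤ q)
    (hG : ∀ j, 2 * κ j + q * G ≤ G) (B : ℝ) {K : ℕ} (hK : 1 ≤ K) (δ : ℕ → ℝ) :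
    ∃ (W : ℕ → ℕ → ℕ → ℝ) (β : ℕ → ℕ → ℝ),
      ∀ (u : ℕ → ℕ → ℝ) (x : (j : Fin (J + 1)) → Fin (d j) → ℝ),
      (∀ t, ∀ o < n, u (t + 1) o = max (∑ i ∈ Finset.range n, W t o i * u t i + β t o) 0) →
      readAt 0 (d 0) (u 0) = x 0 →
      (∀ j : Fin J, l0norm (x j.succ) ≤ κ j) → (∀ j : Fin J, l1norm (x j.succ) ≤ B) →
      (∀ j : Fin J, l1norm (layerNoise D x j) ≤ δ j) →
      ∀ j : Fin (J + 1), l1norm (readAt 0 (d j) (u (j * K)) - x j) ≤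
        errorBound (q ^ K * B) G δ j := by
  set η := errorBound (q ^ K * B) G δ with hη
  -- The proof of `j < J` is quantified inside so that weights can be chosen for all natural `j`;
  -- beyond the last stage they are zero.
  have hrow : ∀ j k o : ℕ, ∃ (w : ℕ → ℝ) (β : ℝ), ∀ (h : j < J) u,
      preStep (D ⟨j, h⟩) (stepThreshold (D ⟨j, h⟩) q B G (η j + δ j) k) k u o =
        ∑ i ∈ Finset.range n, w i * u i + β := by
    intro j k o
    by_cases h : j < J
    · obtain ⟨w, β, hw⟩ := exists_preStep_eq (hn ⟨j, h⟩) (D ⟨j, h⟩)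
        (stepThreshold (D ⟨j, h⟩) q B G (η j + δ j) k) k o
      exact ⟨w, β, fun _ => hw⟩
    · exact ⟨0, 0, fun h' => absurd h' h⟩
  choose W β hW using hrow
  -- Layer `t` performs step `t % K` of stage `t / K`.
  refine ⟨fun t => W (t / K) (t % K), fun t => β (t / K) (t % K), ?_⟩
  intro u x hu h0 hx hxB hδ j
  induction j using Fin.induction with
  | zero =>
    simp only [Fin.val_zero, zero_mul]
    rw [h0, sub_self, hη, errorBound]
    simp [l1norm]
  | succ j ih =>
    have hstep := l1norm_readAt_stage_le (hn j) (hD j) hq hG0 (hκq j) (hG j) hK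
      (B := B) (e := η j + δ j) (U := fun k => u (j * K + k)) (x := x j.succ) ?_ (hx j) (hxB j) ?_
    · rw [Fin.val_succ, add_mul, one_mul, hη, errorBound]
      exact hstep
    · intro k hk o ho
      have e1 : (j * K + k) / K = j := by
        rw [mul_comm, Nat.mul_add_div (by omega), Nat.div_eq_of_lt hk, add_zero]
      have e2 : (j * K + k) % K = k := by
        rw [mul_comm, Nat.mul_add_mod, Nat.mod_eq_of_lt hk]
      have h1 := hu (j * K + k) o ho
      simp only [e1, e2] at h1
      rw [← hW j k o j.2] at h1
      exact h1
    · have e1 : readAt 0 (d j.castSucc) (u (j * K + 0)) - D j *ᵥ x j.succ =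
          (readAt 0 (d j.castSucc) (u (j * K)) - x j.castSucc) + layerNoise D x j := by
        rw [layerNoise, add_zero]
        abel
      rw [e1]
      exact (l1norm_add_le _ _).trans (add_le_add ih (hδ j))

/-! ### Comparing the size of the network with products over the stages -/

theorem card_mul_sq_le_prod_sq {J : ℕ} (N : Fin J → ℝ) (hN : ∀ j, 2 ≤ N j) (i : Fin J) :
    J * N i ^ 2 ≤ ∏ j, N j ^ 2 := by
  classical
  rw [← Finset.mul_prod_erase _ _ (Finset.mem_univ i), mul_comm]
  refine mul_le_mul_of_nonneg_left ?_ (sq_nonneg _)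
  have h1 : (2 : ℝ) ^ (Finset.univ.erase i).card ≤ ∏ j ∈ Finset.univ.erase i, N j ^ 2 := by
    rw [← Finset.prod_const]
    exact Finset.prod_le_prod (fun _ _ => by norm_num) fun j _ => by nlinarith [hN j]
  refine le_trans ?_ h1
  rw [Finset.card_erase_of_mem (Finset.mem_univ i), Finset.card_univ, Fintype.card_fin]
  have hJ : J = (J - 1) + 1 := by have := i.2; omega
  -- The other `J - 1` factors are each at least two, so their product absorbs the number of stages.
  have h2 : J ≤ 2 ^ (J - 1) := by
    have := Nat.lt_two_pow_self (n := J - 1)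
    omega
  exact_mod_cast h2

/-- Each factor is at least `s`, so `J` is at most the logarithm of the product; `Nat.clog s d`
exceeds that logarithm by at most one since `d` is below one factor. The remaining constants are
absorbed because the logarithm is at least one. -/
theorem depth_le_logb_prod {J : ℕ} {s d K : ℕ} (hs : 2 ≤ s) (hK : 1 ≤ K)
    (N : Fin J → ℝ) (i : Fin J) (hi : (d : ℝ) ≤ N i) :
    ((Nat.clog s d + 1 + J * K : ℕ) : ℝ) ≤
      4 * K * Real.logb s (∏ j, max (s : ℝ) (N j)) := by
  have hs1 : (1 : ℝ) < s := by exact_mod_cast hs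
  set P := ∏ j, max (s : ℝ) (N j) with hP
  have hP0 : 0 < P := Finset.prod_pos fun j _ => lt_of_lt_of_le (by linarith) (le_max_left _ _)
  have hle : ∀ m : ℕ, (s : ℝ) ^ m ≤ P → (m : ℝ) ≤ Real.logb s P := by
    intro m hm
    rw [Real.le_logb_iff_rpow_le hs1 hP0]
    exact_mod_cast hm
  have h1 : (J : ℝ) ≤ Real.logb s P := by
    apply hle
    calc (s : ℝ) ^ J = ∏ _j : Fin J, (s : ℝ) := by simp
      _ ≤ P := Finset.prod_le_prod (fun _ _ => by linarith) fun _ _ => le_max_left _ _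
  have h2 : (Nat.clog s d : ℝ) ≤ Real.logb s P + 1 := by
    rcases Nat.eq_zero_or_pos (Nat.clog s d) with h | h
    · rw [h]
      have : (0 : ℝ) ≤ J := by positivity
      push_cast
      linarith
    · obtain ⟨L, hL⟩ := Nat.exists_eq_add_one_of_ne_zero h.ne'
      have h3 : s ^ L < d := Nat.pow_lt_of_lt_clog (by omega)
      have h4 : (s : ℝ) ^ L ≤ d := by exact_mod_cast h3.le
      have h5 : max (s : ℝ) (N i) ≤ P := by
        have := Finset.prod_le_prod_of_subset_of_one_le (f := fun j => max (s : ℝ) (N j))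
          (Finset.subset_univ {i}) (fun _ _ => by positivity)
          (fun _ _ _ => hs1.le.trans (le_max_left _ _))
        simpa using this
      have := hle L (h4.trans (hi.trans ((le_max_right _ _).trans h5)))
      rw [hL]
      push_cast
      linarith
  have hJ : (1 : ℝ) ≤ J := by exact_mod_cast (by have := i.2; omega : 1 ≤ J)
  have hK' : (1 : ℝ) ≤ K := by exact_mod_cast hK
  push_cast
  have h6 : (J : ℝ) * K ≤ K * Real.logb s P := by
    rw [mul_comm]; exact mul_le_mul_of_nonneg_left h1 (by linarith)
  have h7 : 1 * Real.logb s P ≤ K * Real.logb s P :=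
    mul_le_mul_of_nonneg_right hK' (by linarith)
  linarith

theorem mainTheorem1 :
    -- the implied constant of the size bounds is absolute
    ∃ A : ℝ, 0 < A ∧
    ∀ (J : ℕ) (_ : 1 ≤ J) (d : Fin (J + 1) → ℕ) (_ : ∀ j, 1 ≤ d j)
      (D : (j : Fin J) → Matrix (Fin (d j.castSucc)) (Fin (d j.succ)) ℝ)
      (_ : ∀ j, ColumnNormalized (D j)),
    ∃ C_D : ℝ, 0 < C_D ∧
    ∀ (lam : Fin J → ℝ) (_ : ∀ j, 0 ≤ lam j) (_ : ∀ j, UniquenessCondition (D j) (lam j)),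
    ∃ c : ℝ, 0 < c ∧
    ∀ (B : Fin J → ℝ) (_ : ∀ j, 0 ≤ B j),
    ∃ C : ℝ, 0 < C ∧
    ∀ (δ : Fin J → ℝ) (_ : ∀ j, 0 ≤ δ j) (s : ℕ) (_ : 2 ≤ s) (K : ℕ) (_ : 1 ≤ K),
    -- one network, with layers `pos j` carrying the outputs, serves all observations
    ∃ (Φ : ConvNet s (d 0)) (pos : Fin J → ℕ),
      StrictMono pos ∧
      (∀ j : Fin J, (j : ℕ) + 1 = J → pos j = Φ.depth) ∧
      (∀ j : Fin J, Φ.width (pos j) = 1 ∧ 2 * d j.succ ≤ Φ.chan (pos j)) ∧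
      (Φ.depth : ℝ) ≤
        A * K * Real.logb s (∏ j : Fin J, max (s : ℝ) (d j.castSucc + d j.succ)) ∧
      (Φ.numNonzero : ℝ) ≤ A * K * ∏ j : Fin J, ((d j.castSucc : ℝ) + d j.succ) ^ 2 ∧
      (Φ.numParams : ℝ) ≤ A * s * K * ∏ j : Fin J, ((d j.castSucc : ℝ) + d j.succ) ^ 2 ∧
      ∀ (ε : Fin J → ℝ) (y : Fin (d 0) → ℝ) (x : (j : Fin (J + 1)) → Fin (d j) → ℝ),
        (∀ j, 0 ≤ ε j) →
        IsDSCSolution D lam ε y x →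
        (∀ (j : Fin J) (i : Fin (d j.succ)), |x j.succ i| ≤ B j) →
        (∀ j : Fin J, l1norm (layerNoise D x j) ≤ δ j) →
        ∀ j : Fin J,
          l2norm (Φ.signedOutput y (pos j) (d j.succ) - x j.succ) ≤
            C * Real.exp (-c * K) + C_D * ∑ i ∈ Finset.Iic j, δ i := by
  -- The total weight count is the binding one: with `n = 2 * M` channels it gives `5 * 4 * 2 = 40`,
  -- the last factor coming from `J * K + 1 ≤ 2 * (J * K)`.
  refine ⟨40, by norm_num, ?_⟩
  intro J hJ d hd D hD
  have : Nonempty (Fin J) := ⟨⟨0, hJ⟩⟩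
  choose κ hκ hsparse using fun j => exists_sparsity_level (D j)
  obtain ⟨jq, hjq⟩ := Finite.exists_max fun j => (2 * (κ j : ℝ) - 1) * mutualCoherence (D j)
  obtain ⟨jN, hjN⟩ := Finite.exists_max fun j : Fin J => d j.castSucc + d j.succ
  obtain ⟨q, hq0, hq1, hκq⟩ : ∃ q : ℝ, 0 < q ∧ q < 1 ∧
      ∀ j, (2 * (κ j : ℝ) - 1) * mutualCoherence (D j) ≤ q :=
    -- The value `1 / 2` only keeps `q` positive, so that `-Real.log q` is a genuine rate.
    ⟨max (1 / 2) ((2 * (κ jq : ℝ) - 1) * mutualCoherence (D jq)), by positivity,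
      max_lt (by norm_num) (hκ jq), fun j => (hjq j).trans (le_max_right _ _)⟩
  obtain ⟨G, hG1, hG⟩ : ∃ G : ℝ, 1 ≤ G ∧ ∀ j, 2 * (κ j : ℝ) + q * G ≤ G := by
    have h0 : 0 ≤ ∑ j, 2 * (κ j : ℝ) := Finset.sum_nonneg fun _ _ => by positivity
    have hq' : 0 < 1 - q := by linarith
    -- The sum of the geometric series of noise contributions, with all stages added up; the `+ 1`
    -- ensures `1 ≤ G`.
    refine ⟨(∑ j, 2 * (κ j : ℝ)) / (1 - q) + 1, by linarith [div_nonneg h0 hq'.le], fun j => ?_⟩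
    have h1 : 2 * (κ j : ℝ) ≤ ∑ j, 2 * (κ j : ℝ) :=
      Finset.single_le_sum (f := fun j => 2 * (κ j : ℝ)) (fun _ _ => by positivity)
        (Finset.mem_univ j)
    have h2 := div_mul_cancel₀ (∑ j, 2 * (κ j : ℝ)) hq'.ne'
    linarith
  have hG0 : 0 ≤ G := by linarith
  refine ⟨G ^ J, by positivity, ?_⟩
  intro lam _ hu
  refine ⟨-Real.log q, neg_pos.2 (Real.log_neg hq0 hq1), ?_⟩
  intro B hB
  have hdB : ∀ j : Fin J, 0 ≤ d j.succ * B j := fun j => mul_nonneg (Nat.cast_nonneg _) (hB j)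
  obtain ⟨B₀, hB₀, hdB₀⟩ : ∃ B₀ : ℝ, 0 ≤ B₀ ∧ ∀ j : Fin J, d j.succ * B j ≤ B₀ :=
    ⟨∑ j : Fin J, d j.succ * B j, Finset.sum_nonneg fun j _ => hdB j, fun j =>
      Finset.single_le_sum (f := fun j : Fin J => d j.succ * B j) (fun j _ => hdB j)
        (Finset.mem_univ j)⟩
  -- `B₀` bounds the `ℓ₁` norm of every code, and each of the `J` stages contributes at most `q ^ K
  -- * B₀`; the `+ 1` is for strict positivity.
  refine ⟨G ^ J * (J * B₀) + 1, by positivity, ?_⟩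
  intro δ hδ s hs K hK
  set M := d jN.castSucc + d jN.succ with hM
  have hn : ∀ j : Fin J, 2 * (d j.castSucc + d j.succ) ≤ 2 * M := fun j =>
    Nat.mul_le_mul_left 2 (hjN j)
  have hd0 : d 0 ≤ M := by
    have := hjN ⟨0, hJ⟩
    have h0 : (⟨0, hJ⟩ : Fin J).castSucc = 0 := rfl
    rw [h0] at this
    omega
  set δ' : ℕ → ℝ := fun i => if h : i < J then δ ⟨i, h⟩ else 0 with hδ'
  have hδ'0 : ∀ i, 0 ≤ δ' i := by
    intro i
    simp only [hδ']
    split_ifs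
    exacts [hδ _, le_rfl]
  have hδ'j : ∀ j : Fin J, δ' j = δ j := fun j => by simp [hδ']
  have hsum : ∀ j : Fin J, ∑ i ∈ Finset.range ((j : ℕ) + 1), δ' i = ∑ i ∈ Finset.Iic j, δ i := by
    intro j
    refine (Finset.sum_bij (s := Finset.Iic j) (t := Finset.range ((j : ℕ) + 1)) (f := δ) (g := δ')
      (fun i _ => (i : ℕ)) ?_ ?_ ?_ ?_).symm
    · intro i hi
      simpa [Nat.lt_succ_iff] using hi
    · intro i _ i' _ h
      exact Fin.ext h
    · intro i hi
      have hi' : i < (j : ℕ) + 1 := by simpa using hi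
      exact ⟨⟨i, by omega⟩, by simp [Fin.le_def]; omega, rfl⟩
    · intro i _
      exact (hδ'j i).symm
  obtain ⟨W, β, hW⟩ := exists_dense_weights D hD hn hq0.le hG0 hκq hG B₀ hK δ'
  have h2d : 2 * d 0 ≤ 2 * M := by omega
  have hprod : (J : ℝ) * (M : ℝ) ^ 2 ≤ ∏ j : Fin J, ((d j.castSucc : ℝ) + d j.succ) ^ 2 := by
    have := card_mul_sq_le_prod_sq (fun j : Fin J => (d j.castSucc : ℝ) + d j.succ) (fun j => by
      have h1 : (1 : ℝ) ≤ d j.castSucc := by exact_mod_cast hd _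
      have h2 : (1 : ℝ) ≤ d j.succ := by exact_mod_cast hd _
      linarith) jN
    rw [hM]
    push_cast
    exact this
  have hJK : ((J : ℝ) * K + 1) ≤ 2 * (J * K) := by
    have : (1 : ℝ) ≤ J * K := by exact_mod_cast Nat.mul_pos hJ hK
    linarith
  have hM2 : (M : ℝ) ^ 2 * (J * K + 1) ≤
      2 * (K * ∏ j : Fin J, ((d j.castSucc : ℝ) + d j.succ) ^ 2) := by
    calc (M : ℝ) ^ 2 * (J * K + 1) ≤ (M : ℝ) ^ 2 * (2 * (J * K)) := by gcongr
      _ = 2 * (K * (J * (M : ℝ) ^ 2)) := by ring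
      _ ≤ _ := by gcongr
  set P := ∏ j : Fin J, ((d j.castSucc : ℝ) + d j.succ) ^ 2 with hP
  have hP0 : 0 ≤ K * P := mul_nonneg (Nat.cast_nonneg _) (Finset.prod_nonneg fun _ _ => sq_nonneg _)
  refine ⟨ConvNet.gatherDense hs (hd 0) h2d W β (J * K),
    fun j => Nat.clog s (d 0) + 1 + ((j : ℕ) + 1) * K, ?_, ?_, ?_, ?_, ?_, ?_, ?_⟩
  · intro i j hij
    have : ((i : ℕ) + 1) * K < ((j : ℕ) + 1) * K :=
      Nat.mul_lt_mul_of_pos_right (Nat.succ_lt_succ hij) hK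
    simpa using this
  · intro j hj
    simp [ConvNet.gatherDense, hj]
  · intro j
    refine ⟨ConvNet.width_gatherDense .., ?_⟩
    rw [ConvNet.chan_gatherDense]
    have := hn j
    omega
  · have h := depth_le_logb_prod hs hK
      (fun j : Fin J => (d j.castSucc : ℝ) + d j.succ) ⟨0, hJ⟩
      (le_add_of_nonneg_right (Nat.cast_nonneg _))
    refine (show _ ≤ _ from h).trans ?_
    rw [mul_assoc, mul_assoc]
    have h0 := (Nat.cast_nonneg (α := ℝ) (Nat.clog s (d 0) + 1 + J * K)).trans h
    rw [mul_assoc] at h0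
    linarith
  · have h : ((ConvNet.gatherDense hs (hd 0) h2d W β (J * K)).numNonzero : ℝ) ≤
        2 * (2 * M) ^ 2 * (J * K + 1) := by
      exact_mod_cast ConvNet.numNonzero_gatherDense_le hs (hd 0) h2d W β (J * K)
    rw [mul_assoc]
    linarith
  · have h : ((ConvNet.gatherDense hs (hd 0) h2d W β (J * K)).numParams : ℝ) ≤
        5 * s * (2 * M) ^ 2 * (J * K + 1) := by
      exact_mod_cast ConvNet.numParams_gatherDense_le hs (hd 0) h2d W β (J * K)
    refine h.trans ?_
    calc (5 : ℝ) * s * (2 * M) ^ 2 * (J * K + 1) = 20 * s * ((M : ℝ) ^ 2 * (J * K + 1)) := by ring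
      _ ≤ 20 * s * (2 * (K * P)) := by gcongr
      _ = _ := by ring
  · intro ε y x _ hsol hxB hnoise j
    have h := hW (fun t o => (ConvNet.gatherDense hs (hd 0) h2d W β (J * K)).feature y
        (Nat.clog s (d 0) + 1 + t) o 0) x
      (fun t o ho => ConvNet.feature_dense_succ hs (hd 0) h2d W β (J * K) y t o ho) ?_
      (fun j => hsparse j _ _ (hu j) (hsol.sparse j)) ?_ (fun j => by rw [hδ'j]; exact hnoise j)
      j.succ
    · refine (l2norm_le_l1norm _).trans ?_
      have e1 : (ConvNet.gatherDense hs (hd 0) h2d W β (J * K)).signedOutput y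
          (Nat.clog s (d 0) + 1 + ((j : ℕ) + 1) * K) (d j.succ) =
          readAt 0 (d j.succ) (fun o => (ConvNet.gatherDense hs (hd 0) h2d W β (J * K)).feature y
            (Nat.clog s (d 0) + 1 + (j.succ : ℕ) * K) o 0) := by
        funext i
        simp [ConvNet.signedOutput, readAt]
      rw [e1]
      refine h.trans ?_
      have hr : 0 ≤ q ^ K * B₀ := by positivity
      have hS : 0 ≤ ∑ i ∈ Finset.Iic j, δ i := Finset.sum_nonneg fun i _ => hδ i
      have hexp : Real.exp (-(-Real.log q) * K) = q ^ K := by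
        rw [neg_neg, mul_comm, Real.exp_nat_mul, Real.exp_log hq0]
      have hjJ : (((j : ℕ) + 1 : ℕ) : ℝ) ≤ J := by exact_mod_cast j.2
      rw [hexp]
      calc errorBound (q ^ K * B₀) G δ' j.succ
          ≤ G ^ ((j : ℕ) + 1) * (((j : ℕ) + 1 : ℕ) * (q ^ K * B₀) + ∑ i ∈ Finset.Iic j, δ i) := by
            have := errorBound_le hr hG1 hδ'0 ((j : ℕ) + 1)
            rwa [hsum] at this
        _ ≤ G ^ J * (J * (q ^ K * B₀) + ∑ i ∈ Finset.Iic j, δ i) := by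
            gcongr
            exact j.2
        _ = G ^ J * (J * B₀) * q ^ K + G ^ J * ∑ i ∈ Finset.Iic j, δ i := by ring
        _ ≤ _ := by
            have : 0 ≤ q ^ K := by positivity
            linarith
    · funext i
      rw [hsol.zero_eq, ← ConvNet.feature_gather_last hs (hd 0) h2d W β (J * K) y i]
      simp [readAt]
    · intro j
      refine le_trans ?_ (hdB₀ j)
      have := Finset.sum_le_card_nsmul Finset.univ (fun i => |x j.succ i|) (B j)
        fun i _ => hxB j i
      simpa [l1norm] using this
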